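/- There are an absolute constant $c>0$ and, for every $n$, a partition matroid $\mathcal M_n$ on the ground set $[n]=\{1,\dots,n\}$ (given by a partition of $[n]$ into parts $P_1,\dots,P_m$ and integer capacities $u_1,\dots,u_m\ge 0$, a set $S$ being independent iff $|S\cap P_i|\le u_i$ for all $i$), such that the following holds. Let $\alpha>0$ and $C\in\mathbb N$ be constants. Then for all sufficiently large $n$ (depending on $\alpha$ and $C$) and for every randomized algorithm that accesses a matroid on $[n]$ only through an independence oracle (given $S\subseteq[n]$, the oracle answers whether $S$ is independent), makes at most $$\frac{n^{1/3}}{4\alpha\log^2 n}-1$$ sequential steps, each consisting of at most $n^{C}$ parallel queries that may depend on the answers obtained in earlier steps but not on each other's answers, and then outputs a set $S$ (with no restriction on computation between queries): 1. If the algorithm is run on $\mathcal M_n$ with its ground set relabelled by a hidden, uniformly random permutation of $[n]$ (equivalently, the partition into parts is uniformly random among all ordered partitions with the same part sizes), then with probability at most $n^{-c\log n}$, over the permutation and the random bits of the algorithm, the output $S$ is an $\alpha$-approximation for maximizing the cardinality function $f(S)=|S|$ over independent sets, i.e. $S$ is independent and $|T|\le\alpha|S|$ for every independent set $T$. 2.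 In particular, there is a fixed partition matroid on $[n]$ (a relabelling of $\mathcal M_n$) on which the algorithm outputs an $\alpha$-approximation with probability at most $n^{-c\log n}$ over its random bits. Here $\log$ is the natural logarithm. -/

import Mathlib

/-- The partition matroid on the ground set `Fin n` in which element `a` lies in the part
`part a`, and a set is independent iff it has at most `cap i` elements in each part `i`. -/
def partitionMatroid {n m : ℕ} (part : Fin n → Fin m) (cap : Fin m → ℕ) : Matroid (Fin n) :=
  (IndepMatroid.ofFinset Set.univ
    (fun S : Finset (Fin n) => ∀ i, (S.filter (fun a => part a = i)).card ≤ cap i)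
    (by simp)
    (fun I J hJ hIJ i => (Finset.card_le_card (Finset.filter_subset_filter _ hIJ)).trans (hJ i))
    (by
      intro I J hI hJ hlt
      have hcard : ∀ S : Finset (Fin n),
          S.card = ∑ i : Fin m, (S.filter (fun a => part a = i)).card := fun S =>
        Finset.card_eq_sum_card_fiberwise (fun a _ => Finset.mem_coe.2 (Finset.mem_univ _))
      obtain ⟨i, hi⟩ : ∃ i, (I.filter (fun a => part a = i)).card <
          (J.filter (fun a => part a = i)).card := by
        by_contra! hcon
        have := Finset.sum_le_sum (s := Finset.univ) (fun i _ => hcon i)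
        rw [← hcard, ← hcard] at this
        omega
      obtain ⟨e, heJ, heI⟩ := Finset.exists_mem_notMem_of_card_lt_card hi
      rw [Finset.mem_filter] at heJ heI
      refine ⟨e, heJ.1, fun h => heI ⟨h, heJ.2⟩, fun j => ?_⟩
      rw [Finset.filter_insert]
      split_ifs with hj
      · have hij : i = j := heJ.2.symm.trans hj
        subst hij
        exact (Finset.card_insert_le _ _).trans (hi.trans_le (hJ i))
      · exact hI j)
    (fun _ _ => Set.subset_univ _)).matroid

theorem partitionMatroid_indep_iff {n m : ℕ} (part : Fin n → Fin m) (cap : Fin m → ℕ)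
    (S : Finset (Fin n)) :
    (partitionMatroid part cap).Indep (S : Set (Fin n)) ↔
      ∀ i, (S.filter (fun a => part a = i)).card ≤ cap i := by
  simp [partitionMatroid]

/-- The independence oracle of a matroid: it answers whether the queried set is independent. -/
noncomputable def indepOracle {n : ℕ} (M : Matroid (Fin n)) : Finset (Fin n) → Bool :=
  open Classical in fun S => decide (M.Indep (S : Set (Fin n)))

/-- A deterministic algorithm on the ground set `Fin n` that makes `r` sequential steps of `q`
parallel queries to an oracle and then outputs a set. The queries of step `i` may depend, in an
arbitrary way, on the answers received in the steps before `i`, but not on the answers to other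
queries of step `i`. Queries may be repeated and answers ignored, so that algorithms making at most
`r` steps of at most `q` queries are covered. No bound is put on the computation between
queries. -/
structure QueryAlgorithm (n r q : ℕ) where
  query : (i : Fin r) → (Fin i → Fin q → Bool) → Fin q → Finset (Fin n)
  output : (Fin r → Fin q → Bool) → Finset (Fin n)

namespace QueryAlgorithm

variable {n r q : ℕ}

/-- The answers that the algorithm receives in its first `i` steps when it is run with the
oracle `O`. -/
def answers (D : QueryAlgorithm n r q) (O : Finset (Fin n) → Bool) :
    (i : ℕ) → i ≤ r → Fin i → Fin q → Bool
  | 0, _ => fun j => j.elim0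
  | i + 1, h =>
      Fin.snoc (α := fun _ => Fin q → Bool) (answers D O i (Nat.le_of_succ_le h))
        (fun k => O (D.query ⟨i, h⟩ (answers D O i (Nat.le_of_succ_le h)) k))

/-- The set returned by the algorithm when it is run with the oracle `O`. -/
def run (D : QueryAlgorithm n r q) (O : Finset (Fin n) → Bool) : Finset (Fin n) :=
  D.output (D.answers O r le_rfl)

end QueryAlgorithm

/-- `S` is an `α`-approximate solution of the problem of maximizing `f` over the independent sets
of `M`: it is feasible, and `f T ≤ α * f S` for every feasible `T`, that is, `OPT ≤ α * f S`. -/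
def IsApproxSolution {n : ℕ} (M : Matroid (Fin n)) (f : Finset (Fin n) → ℝ) (α : ℝ)
    (S : Finset (Fin n)) : Prop :=
  M.Indep (S : Set (Fin n)) ∧
    ∀ T : Finset (Fin n), M.Indep (T : Set (Fin n)) → f T ≤ α * f S

/-- A randomized algorithm is a probability distribution over deterministic ones. As there are only
finitely many deterministic algorithms for given `n`, `r`, `q`, every source of random
bits, used at any time during the run, gives such a distribution. -/
abbrev RandomizedAlgorithm (n r q : ℕ) := PMF (QueryAlgorithm n r q)

/-- The probability, over the random bits of the algorithm `A`, that `A` with access to the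
independence oracle of `M` returns an `α`-approximate solution of the problem of maximizing the
cardinality function `S ↦ |S|` over the independent sets of `M`. -/
noncomputable def RandomizedAlgorithm.successProb {n r q : ℕ} (A : RandomizedAlgorithm n r q)
    (M : Matroid (Fin n)) (α : ℝ) : ℝ :=
  (A.toOuterMeasure
    {D | IsApproxSolution M (fun S => (S.card : ℝ)) α (D.run (indepOracle M))}).toReal

/-- The probability of success of `A`, over its random bits and an independent uniformly random
permutation `σ` of the ground set, on the partition matroid that is hidden by relabelling its
ground set by `σ`. The parts `(part ∘ σ)⁻¹ (i)` form a uniformly random ordered partition of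
`Fin n` among those whose parts have the same sizes as the parts of `part`. -/
noncomputable def RandomizedAlgorithm.hiddenSuccessProb {n r q m : ℕ}
    (A : RandomizedAlgorithm n r q) (part : Fin n → Fin m) (cap : Fin m → ℕ) (α : ℝ) : ℝ :=
  (∑ σ : Equiv.Perm (Fin n), A.successProb (partitionMatroid (part ∘ σ) cap) α) /
    (Nat.factorial n : ℝ)

/-! Take about n^(1/3)/log² n blocks; write m for their number, g = m⌈log² n⌉, and give block i size
mg and capacity ig. The leftover elements form part 0, of capacity 0. Each step reveals essentially
one more block. While the blocks from i on are hidden, a query meets block i and each later block in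
nearly equal numbers, so if it respects the capacity ig it stays below (i+1)g in the later blocks,
and the answer depends on the first i blocks only. After r steps an independent output therefore has
at most m(r+2)g elements, against an optimum of m(m+1)g/2.

Conditioning on past answers is avoided by a hybrid run, in which step t (counted from 0) is
answered by `prefixOracle`, blind to blocks beyond t+1. Its step-t queries are exactly invariant
under exchanges of elements between block t+1 and a later block, and it coincides with the true run
unless one of its queries is `Unbalanced`. `card_unbalanced_mul_le` bounds each such event through a
product potential of mean 1, giving probability at most exp(-g/(16m)) ≤ exp(-log² n/16). The union
bound in `card_large_output_mul_le` costs only a polynomial factor. Averaging over deterministic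
algorithms and over relabellings gives both claims. -/

/-! ### Concentration by a product potential -/

open Finset in
theorem card_filter_apply_eq_sum {n s m : ℕ} {part : Fin n → Fin (m + 1)}
    {e : Fin m → Fin s → Fin n} (he : ∀ i, Function.Injective (e i))
    (hpart : ∀ a i, part a = Fin.succ i ↔ ∃ k, e i k = a) (σ : Equiv.Perm (Fin n))
    (S : Finset (Fin n)) (i : Fin m) :
    (S.filter (fun a => (part ∘ σ) a = i.succ)).card =
      ∑ k, if σ.symm (e i k) ∈ S then 1 else 0 := by
  rw [← Finset.card_filter]
  symm
  refine Finset.card_bij (fun k _ => σ.symm (e i k)) ?_ ?_ ?_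
  · intro k hk
    simp only [mem_filter, mem_univ, true_and] at hk
    simp only [mem_filter, Function.comp, Equiv.apply_symm_apply, hk, true_and]
    exact (hpart _ _).2 ⟨k, rfl⟩
  · intro k _ l _ h
    exact he i (σ.symm.injective h)
  · intro a ha
    simp only [mem_filter, Function.comp] at ha
    obtain ⟨k, hk⟩ := (hpart _ _).1 ha.2
    refine ⟨k, ?_, ?_⟩
    · simp [hk, ha.1]
    · simp [hk]

/-- The factor of the pair `(a, b)` of positions in the potential: positions outside `S` and `S`
are balanced when the entries of `a` and `b` are exchanged. -/
noncomputable def pairFactor {n : ℕ} (x : ℝ) (S : Finset (Fin n)) (σ : Equiv.Perm (Fin n))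
    (a b : Fin n) : ℝ :=
  1 + x * ((if σ.symm b ∈ S then 1 else 0) - (if σ.symm a ∈ S then 1 else 0))

theorem symm_swap_mul_apply {n : ℕ} (σ : Equiv.Perm (Fin n)) (a b c : Fin n) :
    (Equiv.swap a b * σ).symm c = σ.symm (Equiv.swap a b c) := by
  rw [Equiv.symm_apply_eq]
  simp

theorem pairFactor_swap {n : ℕ} (x : ℝ) (S : Finset (Fin n)) (σ : Equiv.Perm (Fin n))
    (a b : Fin n) :
    pairFactor x S (Equiv.swap a b * σ) a b = 2 - pairFactor x S σ a b := by
  simp only [pairFactor, symm_swap_mul_apply, Equiv.swap_apply_left, Equiv.swap_apply_right]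
  ring

theorem pairFactor_swap_of_ne {n : ℕ} (x : ℝ) (S : Finset (Fin n)) (σ : Equiv.Perm (Fin n))
    {a b c d : Fin n} (hca : c ≠ a) (hcb : c ≠ b) (hda : d ≠ a) (hdb : d ≠ b) :
    pairFactor x S (Equiv.swap a b * σ) c d = pairFactor x S σ c d := by
  simp only [pairFactor, symm_swap_mul_apply, Equiv.swap_apply_of_ne_of_ne hca hcb,
    Equiv.swap_apply_of_ne_of_ne hda hdb]

/-- Equality holds except when both entries lie in `S`, where the claim is (1+x)(1-x) ≤ 1. -/
theorem mul_pow_ite_le_pairFactor {n : ℕ} {x : ℝ} (S : Finset (Fin n))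
    (σ : Equiv.Perm (Fin n)) (a b : Fin n) :
    (1 + x) ^ (if σ.symm b ∈ S then 1 else 0) * (1 - x) ^ (if σ.symm a ∈ S then 1 else 0) ≤
      pairFactor x S σ a b := by
  unfold pairFactor
  split_ifs <;> simp
  nlinarith [sq_nonneg x]

theorem pairFactor_nonneg {n : ℕ} {x : ℝ} (hx0 : 0 ≤ x) (hx1 : x ≤ 1) (S : Finset (Fin n))
    (σ : Equiv.Perm (Fin n)) (a b : Fin n) : 0 ≤ pairFactor x S σ a b := by
  unfold pairFactor
  split_ifs <;> simp <;> linarith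

theorem sum_prod_pairFactor {n : ℕ} {ι : Type*} [DecidableEq ι] (x : ℝ)
    (S : Equiv.Perm (Fin n) → Finset (Fin n)) (a b : ι → Fin n)
    (ha : Function.Injective a) (hb : Function.Injective b) (hab : ∀ k l, a k ≠ b l)
    (hS : ∀ σ k, S (Equiv.swap (a k) (b k) * σ) = S σ) (K : Finset ι) :
    ∑ σ, ∏ k ∈ K, pairFactor x (S σ) σ (a k) (b k) = (n.factorial : ℝ) := by
  induction K using Finset.induction_on with
  | empty => simp [Fintype.card_perm]
  | insert l K hl ih =>
    -- Reindexing by this swap reflects the factor of `l` about 1 and fixes the other factors, so on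
    -- average that factor contributes 1.
    have hswap := Equiv.sum_comp (Equiv.mulLeft (Equiv.swap (a l) (b l)))
      (fun σ => ∏ k ∈ insert l K, pairFactor x (S σ) σ (a k) (b k))
    have hrw : ∀ σ : Equiv.Perm (Fin n),
        ∏ k ∈ insert l K, pairFactor x (S (Equiv.swap (a l) (b l) * σ))
          (Equiv.swap (a l) (b l) * σ) (a k) (b k) =
        2 * ∏ k ∈ K, pairFactor x (S σ) σ (a k) (b k) -
          ∏ k ∈ insert l K, pairFactor x (S σ) σ (a k) (b k) := by
      intro σ
      rw [hS, Finset.prod_insert hl, Finset.prod_insert hl, pairFactor_swap]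
      rw [Finset.prod_congr rfl (g := fun k => pairFactor x (S σ) σ (a k) (b k))]
      · ring
      · intro k hk
        have hkl : k ≠ l := fun h => hl (h ▸ hk)
        exact pairFactor_swap_of_ne _ _ _ (fun h => hkl (ha h)) (hab k l)
          (fun h => hab l k h.symm) (fun h => hkl (hb h))
    simp only [Equiv.coe_mulLeft, hrw, Finset.sum_sub_distrib, ← Finset.mul_sum, ih] at hswap
    linarith

-- Markov's inequality for the potential of mean 1. `S` may depend on the permutation, but not on
-- how matched elements of the two blocks are exchanged.
open Finset in
open Classical in
theorem card_unbalanced_mul_le {n s m : ℕ} {part : Fin n → Fin (m + 1)}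
    {e : Fin m → Fin s → Fin n} (he : ∀ i, Function.Injective (e i))
    (hpart : ∀ a i, part a = Fin.succ i ↔ ∃ k, e i k = a)
    {x : ℝ} (hx0 : 0 ≤ x) (hx1 : x ≤ 1) (u g : ℕ)
    (S : Equiv.Perm (Fin n) → Finset (Fin n)) {i j : Fin m} (hij : i ≠ j)
    (hS : ∀ σ k, S (Equiv.swap (e i k) (e j k) * σ) = S σ) :
    ((univ.filter (fun σ : Equiv.Perm (Fin n) =>
        ((S σ).filter (fun a => (part ∘ σ) a = i.succ)).card ≤ u ∧
        u + g ≤ ((S σ).filter (fun a => (part ∘ σ) a = j.succ)).card)).card : ℝ) *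
      ((1 + x) ^ g * (1 - x ^ 2) ^ u) ≤ (n.factorial : ℝ) := by
  have hne : ∀ k l, e i k ≠ e j l := by
    intro k l h
    have h1 := (hpart (e i k) i).2 ⟨k, rfl⟩
    have h2 := (hpart (e i k) j).2 ⟨l, h.symm⟩
    exact hij (Fin.succ_injective _ (h1.symm.trans h2))
  rw [← sum_prod_pairFactor x S (e i) (e j) (he i) (he j) hne hS univ, ← nsmul_eq_mul]
  refine (card_nsmul_le_sum _ (fun σ => ∏ k, pairFactor x (S σ) σ (e i k) (e j k)) _ ?_).trans
    (sum_le_sum_of_subset_of_nonneg (filter_subset _ _)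
      fun σ _ _ => prod_nonneg fun k _ => pairFactor_nonneg hx0 hx1 _ _ _ _)
  intro σ hσ
  simp only [mem_filter, mem_univ, true_and] at hσ
  obtain ⟨hX, hY⟩ := hσ
  calc (1 + x) ^ g * (1 - x ^ 2) ^ u = (1 + x) ^ (u + g) * (1 - x) ^ u := by
        rw [show 1 - x ^ 2 = (1 + x) * (1 - x) by ring, mul_pow, pow_add]; ring
    _ ≤ (1 + x) ^ ((S σ).filter (fun a => (part ∘ σ) a = j.succ)).card *
        (1 - x) ^ ((S σ).filter (fun a => (part ∘ σ) a = i.succ)).card := by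
        refine mul_le_mul (pow_le_pow_right₀ (by linarith) hY)
          (pow_le_pow_of_le_one (by linarith) (by linarith) hX)
          (pow_nonneg (by linarith) _) (pow_nonneg (by linarith) _)
    _ = ∏ k, ((1 + x) ^ (if σ.symm (e j k) ∈ S σ then 1 else 0) *
          (1 - x) ^ (if σ.symm (e i k) ∈ S σ then 1 else 0)) := by
        rw [card_filter_apply_eq_sum he hpart, card_filter_apply_eq_sum he hpart,
          prod_mul_distrib, prod_pow_eq_pow_sum, prod_pow_eq_pow_sum]
    _ ≤ _ := prod_le_prod (fun k _ => mul_nonneg (pow_nonneg (by linarith) _)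
          (pow_nonneg (by linarith) _)) fun k _ => mul_pow_ite_le_pairFactor _ _ _ _

/-- The choice x = 1/(2m) maximizes the gain gx less the loss mgx². Bernoulli's inequality bounds
the loss per unit of g. -/
theorem exp_le_one_add_pow_mul {m g u : ℕ} (hm : 0 < m) (hu : u ≤ m * g) :
    Real.exp ((g : ℝ) / (16 * m)) ≤
      (1 + 1 / (2 * (m : ℝ))) ^ g * (1 - (1 / (2 * (m : ℝ))) ^ 2) ^ u := by
  have hm1 : (1 : ℝ) ≤ m := by exact_mod_cast hm
  set y : ℝ := 1 / m with hy
  have hmy : (m : ℝ) * y = 1 := by rw [hy]; field_simp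
  have hy0 : 0 < y := by positivity
  have hy1 : y ≤ 1 := by rw [hy, div_le_one (by linarith)]; exact hm1
  have hx : 1 / (2 * (m : ℝ)) = y / 2 := by rw [hy]; field_simp
  rw [hx]
  have hb0 : 0 ≤ 1 - (y / 2) ^ 2 := by nlinarith
  have hbern : 1 - y / 4 ≤ (1 - (y / 2) ^ 2) ^ m := by
    have h := one_add_mul_le_pow (a := -(y / 2) ^ 2) (by nlinarith) m
    have h2 : (m : ℝ) * -(y / 2) ^ 2 = - (y / 4) := by
      have : (m : ℝ) * -(y / 2) ^ 2 = -(m * y) * y / 4 := by ring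
      rw [this, hmy]; ring
    rw [h2] at h
    simpa [sub_eq_add_neg] using h
  have hexp : Real.exp (y / 16) ≤ (1 + y / 2) * (1 - (y / 2) ^ 2) ^ m := by
    have h1 : Real.exp (y / 16) ≤ 1 / (1 - y / 16) := by
      rw [le_div_iff₀ (by linarith)]
      have := Real.add_one_le_exp (-(y / 16))
      calc Real.exp (y / 16) * (1 - y / 16) ≤ Real.exp (y / 16) * Real.exp (-(y / 16)) :=
            mul_le_mul_of_nonneg_left (by linarith) (Real.exp_pos _).le
        _ = 1 := by rw [← Real.exp_add]; simp
    refine h1.trans (le_trans ?_ (mul_le_mul_of_nonneg_left hbern (by linarith)))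
    rw [div_le_iff₀ (by linarith)]
    nlinarith [mul_nonneg hy0.le (sub_nonneg.2 hy1), mul_pos hy0 (pow_pos hy0 2)]
  calc Real.exp ((g : ℝ) / (16 * m)) = Real.exp (y / 16) ^ g := by
        rw [← Real.exp_nat_mul, hy]; congr 1; field_simp
    _ ≤ ((1 + y / 2) * (1 - (y / 2) ^ 2) ^ m) ^ g := pow_le_pow_left₀ (Real.exp_pos _).le hexp _
    _ = (1 + y / 2) ^ g * (1 - (y / 2) ^ 2) ^ (m * g) := by rw [mul_pow, ← pow_mul]
    _ ≤ _ := mul_le_mul_of_nonneg_left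
          (pow_le_pow_of_le_one hb0 (by nlinarith) hu) (by positivity)

/-! ### Runs whose oracle changes from step to step -/

namespace QueryAlgorithm

variable {n r q : ℕ}

/-- The answers that the algorithm receives in its first `i` steps when the queries of step `t`
are answered by the oracle `O t`. -/
def hybridAnswers (D : QueryAlgorithm n r q) (O : ℕ → Finset (Fin n) → Bool) :
    (i : ℕ) → i ≤ r → Fin i → Fin q → Bool
  | 0, _ => fun j => j.elim0
  | i + 1, h =>
      Fin.snoc (α := fun _ => Fin q → Bool) (hybridAnswers D O i (Nat.le_of_succ_le h))
        (fun k => O i (D.query ⟨i, h⟩ (hybridAnswers D O i (Nat.le_of_succ_le h)) k))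

/-- The `k`-th query of step `t` in the run with the oracles `O`. -/
def hybridQuery (D : QueryAlgorithm n r q) (O : ℕ → Finset (Fin n) → Bool) (t : Fin r)
    (k : Fin q) : Finset (Fin n) :=
  D.query t (D.hybridAnswers O t t.2.le) k

/-- The output of the run with the oracles `O`. -/
def hybridRun (D : QueryAlgorithm n r q) (O : ℕ → Finset (Fin n) → Bool) : Finset (Fin n) :=
  D.output (D.hybridAnswers O r le_rfl)

theorem hybridAnswers_congr (D : QueryAlgorithm n r q) {O O' : ℕ → Finset (Fin n) → Bool} :
    ∀ (i : ℕ) (hi : i ≤ r), (∀ t < i, O t = O' t) →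
      D.hybridAnswers O i hi = D.hybridAnswers O' i hi
  | 0, _, _ => rfl
  | i + 1, h, hO => by
    simp only [hybridAnswers, hO i (Nat.lt_succ_self i),
      hybridAnswers_congr D i (Nat.le_of_succ_le h) fun t ht => hO t (ht.trans (Nat.lt_succ_self i))]

/-- Agreement is needed only on the queries of the hybrid run: inductively, the true run asks the
same ones. -/
theorem answers_eq_hybridAnswers (D : QueryAlgorithm n r q) (O : Finset (Fin n) → Bool)
    (O' : ℕ → Finset (Fin n) → Bool)
    (h : ∀ (t : Fin r) k, O (D.hybridQuery O' t k) = O' t (D.hybridQuery O' t k)) :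
    ∀ (i : ℕ) (hi : i ≤ r), D.answers O i hi = D.hybridAnswers O' i hi
  | 0, _ => rfl
  | i + 1, hi => by
    have hq : ∀ k, O (D.query ⟨i, hi⟩ (D.hybridAnswers O' i (Nat.le_of_succ_le hi)) k) =
        O' i (D.query ⟨i, hi⟩ (D.hybridAnswers O' i (Nat.le_of_succ_le hi)) k) :=
      h ⟨i, hi⟩
    simp only [answers, hybridAnswers, answers_eq_hybridAnswers D O O' h i, hq]

theorem run_eq_hybridRun (D : QueryAlgorithm n r q) (O : Finset (Fin n) → Bool)
    (O' : ℕ → Finset (Fin n) → Bool)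
    (h : ∀ (t : Fin r) k, O (D.hybridQuery O' t k) = O' t (D.hybridQuery O' t k)) :
    D.run O = D.hybridRun O' := by
  rw [run, hybridRun, answers_eq_hybridAnswers D O O' h]

end QueryAlgorithm

/-! ### Prefix oracles and balanced sets -/

/-- The oracle that checks the capacities `i * g` of the parts `i ≤ t + 1` only. -/
def prefixOracle {n m : ℕ} (part : Fin n → Fin (m + 1)) (g t : ℕ) (S : Finset (Fin n)) : Bool :=
  decide (∀ i : Fin (m + 1), (i : ℕ) ≤ t + 1 → (S.filter (fun a => part a = i)).card ≤ i * g)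

theorem prefixOracle_congr {n m : ℕ} {part part' : Fin n → Fin (m + 1)} {g t : ℕ}
    (h : ∀ (a : Fin n) (i : Fin (m + 1)), (i : ℕ) ≤ t + 1 → (part a = i ↔ part' a = i)) :
    prefixOracle part g t = prefixOracle part' g t := by
  funext S
  simp only [prefixOracle, decide_eq_decide]
  refine forall_congr' fun i => forall_congr' fun hi => ?_
  simp only [h _ i hi]

theorem apply_swap_eq_iff {n m : ℕ} (part : Fin n → Fin m) {a b : Fin n} {i : Fin m}
    (ha : part a ≠ i) (hb : part b ≠ i) (c : Fin n) :
    part (Equiv.swap a b c) = i ↔ part c = i := by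
  rcases eq_or_ne c a with rfl | hca
  · simp [ha, hb]
  rcases eq_or_ne c b with rfl | hcb
  · simp [ha, hb]
  rw [Equiv.swap_apply_of_ne_of_ne hca hcb]

/-- The set `S` meets part `i` within its capacity `i * g`, and part `j` in at least `(i + 1) * g`
elements. -/
def Unbalanced {n m : ℕ} (part : Fin n → Fin (m + 1)) (g : ℕ) (S : Finset (Fin n))
    (i j : Fin m) : Prop :=
  (S.filter (fun a => part a = i.succ)).card ≤ (i + 1) * g ∧
    (i + 1) * g + g ≤ (S.filter (fun a => part a = j.succ)).card

/-- A violation seen only beyond part t+1 needs more than (t+2)g elements in a later part, hence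
imbalance against part t+1. -/
theorem indepOracle_eq_prefixOracle {n m : ℕ} {part : Fin n → Fin (m + 1)} {g : ℕ}
    {S : Finset (Fin n)} {t : Fin m} (h : ∀ j, t < j → ¬ Unbalanced part g S t j) :
    indepOracle (partitionMatroid part fun i => i * g) S = prefixOracle part g t S := by
  simp only [indepOracle, prefixOracle, decide_eq_decide, partitionMatroid_indep_iff]
  refine ⟨fun H i _ => H i, fun H i => ?_⟩
  by_cases hi : (i : ℕ) ≤ t + 1
  · exact H i hi
  push Not at hi
  obtain ⟨j, rfl⟩ := Fin.exists_succ_eq.2 (show i ≠ 0 by rintro rfl; simp at hi)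
  by_contra! hc
  have htj : t < j := by
    rw [Fin.val_succ] at hi
    exact Fin.lt_def.2 (by omega)
  refine h j htj ⟨by simpa using H t.succ (by simp), le_trans ?_ hc.le⟩
  have : (t : ℕ) + 2 ≤ (j.succ : Fin (m + 1)) := by simp; exact htj
  calc ((t : ℕ) + 1) * g + g = (t + 2) * g := by ring
    _ ≤ _ := Nat.mul_le_mul_right _ this

theorem card_le_of_not_unbalanced {n m : ℕ} {part : Fin n → Fin (m + 1)} {g : ℕ}
    {S : Finset (Fin n)} {t : Fin m} (h : ∀ j, t < j → ¬ Unbalanced part g S t j)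
    (hS : (partitionMatroid part fun i => i * g).Indep (S : Set (Fin n))) :
    S.card ≤ m * ((t + 2) * g) := by
  rw [partitionMatroid_indep_iff] at hS
  rw [Finset.card_eq_sum_card_fiberwise (f := part) (t := Finset.univ) (by simp),
    Fin.sum_univ_succ]
  have h0 := hS 0
  simp only [Fin.coe_ofNat_eq_mod, Nat.zero_mod, zero_mul, Nat.le_zero] at h0
  rw [h0, zero_add]
  refine (Finset.sum_le_card_nsmul _ _ ((t + 2) * g) fun j _ => ?_).trans (by simp)
  rcases le_or_gt j t with hjt | hjt
  · refine (hS j.succ).trans (Nat.mul_le_mul_right _ ?_)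
    have : (j : ℕ) ≤ t := hjt
    simp; omega
  · have h1 := h j hjt
    rw [Unbalanced, not_and, not_le] at h1
    have h2 := h1 (by simpa using hS t.succ)
    linarith

/-- Blocks are large enough to fill every capacity, so the optimum is at least g(1 + ... + m). -/
theorem exists_indep_card {n m s : ℕ} {part : Fin n → Fin (m + 1)} {e : Fin m → Fin s → Fin n}
    (he : ∀ i, Function.Injective (e i)) (hpart : ∀ a i, part a = Fin.succ i ↔ ∃ k, e i k = a)
    {g : ℕ} (hs : m * g ≤ s) (σ : Equiv.Perm (Fin n)) :
    ∃ T : Finset (Fin n), (partitionMatroid (part ∘ σ) fun i => i * g).Indep (T : Set (Fin n)) ∧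
      2 * T.card = m * (m + 1) * g := by
  have hsub : ∀ i : Fin (m + 1), ∃ T ⊆ Finset.univ.filter (fun a => (part ∘ σ) a = i),
      T.card = i * g := by
    intro i
    refine Finset.exists_subset_card_eq ?_
    induction i using Fin.cases with
    | zero => simp
    | succ i =>
      rw [card_filter_apply_eq_sum he hpart]
      simp only [Finset.mem_univ, if_true, Finset.sum_const, Finset.card_univ, Fintype.card_fin,
        smul_eq_mul, mul_one]
      exact (Nat.mul_le_mul_right _ (by simp)).trans hs
  choose T hT hcard using hsub
  have hfib : ∀ i, ((Finset.univ.biUnion T).filter fun a => (part ∘ σ) a = i) = T i := by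
    intro i
    ext a
    simp only [Finset.mem_filter, Finset.mem_biUnion, Finset.mem_univ, true_and]
    constructor
    · rintro ⟨⟨j, hj⟩, hi⟩
      have := (Finset.mem_filter.1 (hT j hj)).2
      rw [← hi, this]; exact hj
    · intro ha
      exact ⟨⟨i, ha⟩, (Finset.mem_filter.1 (hT i ha)).2⟩
  refine ⟨Finset.univ.biUnion T, ?_, ?_⟩
  · rw [partitionMatroid_indep_iff]
    intro i
    rw [hfib, hcard]
  · rw [Finset.card_eq_sum_card_fiberwise (f := part ∘ σ) (t := Finset.univ) (by simp)]
    simp only [hfib, hcard]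
    rw [← Finset.sum_mul, Fin.sum_univ_eq_sum_range (fun i => i), ← mul_assoc, mul_comm 2,
      Finset.sum_range_id_mul_two]
    simp [mul_comm]

/-! ### Union bound over queries and output -/

open Finset in
open Classical in
/-- The number of relabellings on which a deterministic algorithm returns a set that is larger
than `m * ((r + 2) * g)`, up to scaling. -/
theorem card_large_output_mul_le {n m s r q g : ℕ} {part : Fin n → Fin (m + 1)}
    {e : Fin m → Fin s → Fin n}
    (he : ∀ i, Function.Injective (e i)) (hpart : ∀ a i, part a = Fin.succ i ↔ ∃ k, e i k = a)
    (hr : r < m) (D : QueryAlgorithm n r q) :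
    ((univ.filter (fun σ : Equiv.Perm (Fin n) =>
        (partitionMatroid (part ∘ σ) fun i => i * g).Indep
          (D.run (indepOracle (partitionMatroid (part ∘ σ) fun i => i * g)) : Set (Fin n)) ∧
        m * ((r + 2) * g) <
          (D.run (indepOracle (partitionMatroid (part ∘ σ) fun i => i * g))).card)).card : ℝ) *
      Real.exp ((g : ℝ) / (16 * m)) ≤ ((r * q + 1) * m : ℕ) * (n.factorial : ℝ) := by
  have hm : 0 < m := by omega
  set O : Equiv.Perm (Fin n) → ℕ → Finset (Fin n) → Bool :=
    fun σ => prefixOracle (part ∘ σ) g with hO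
  -- the index type of all sets whose balance matters: the queries and the output
  let step : Option (Fin r × Fin q) → Fin m := fun z =>
    z.elim ⟨r, hr⟩ fun p => ⟨p.1, p.1.2.trans hr⟩
  let Q : Option (Fin r × Fin q) → Equiv.Perm (Fin n) → Finset (Fin n) := fun z σ =>
    z.elim (D.hybridRun (O σ)) fun p => D.hybridQuery (O σ) p.1 p.2
  -- Oracle `t` reads parts up to t+1 ≤ i, while the exchanged elements lie in parts i+1 and j+1.
  have hOswap : ∀ (i j : Fin m), i < j → ∀ σ k, ∀ t < (i : ℕ),
      O (Equiv.swap (e i k) (e j k) * σ) t = O σ t := by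
    intro i j hij σ k t ht
    refine prefixOracle_congr fun a l hl => ?_
    have hi := (hpart (e i k) i).2 ⟨k, rfl⟩
    have hj := (hpart (e j k) j).2 ⟨k, rfl⟩
    have hij' : (i : ℕ) < j := hij
    exact apply_swap_eq_iff part (by rw [hi]; rintro rfl; simp at hl; omega)
      (by rw [hj]; rintro rfl; simp at hl; omega) (σ a)
  have hQ : ∀ z j, step z < j → ∀ σ k, Q z (Equiv.swap (e (step z) k) (e j k) * σ) = Q z σ := by
    intro z j hz σ k
    have := hOswap (step z) j hz σ k
    rcases z with _ | p
    · exact congrArg D.output (D.hybridAnswers_congr _ _ this)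
    · exact congrFun (congrArg (D.query p.1) (D.hybridAnswers_congr _ _ this)) p.2
  let B : Option (Fin r × Fin q) × Fin m → Finset (Equiv.Perm (Fin n)) := fun z =>
    univ.filter fun σ => step z.1 < z.2 ∧ Unbalanced (part ∘ σ) g (Q z.1 σ) (step z.1) z.2
  have hB : ∀ z, ((B z).card : ℝ) * Real.exp ((g : ℝ) / (16 * m)) ≤ (n.factorial : ℝ) := by
    rintro ⟨z, j⟩
    by_cases hz : step z < j
    · have hu : ((step z : ℕ) + 1) * g ≤ m * g := Nat.mul_le_mul_right _ (step z).2
      have hx1 : 1 / (2 * (m : ℝ)) ≤ 1 := by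
        have : (1 : ℝ) ≤ m := by exact_mod_cast hm
        rw [div_le_one (by linarith)]; linarith
      have h1 := card_unbalanced_mul_le he hpart (by positivity) hx1 (((step z : ℕ) + 1) * g) g
        (Q z) hz.ne (hQ z j hz)
      refine le_trans (mul_le_mul_of_nonneg_left (exp_le_one_add_pow_mul hm hu)
        (Nat.cast_nonneg _)) (le_trans (le_of_eq ?_) h1)
      simp only [B, Unbalanced, hz, true_and]
    · simp [B, hz]
  have hcover : univ.filter (fun σ : Equiv.Perm (Fin n) =>
        (partitionMatroid (part ∘ σ) fun i => i * g).Indep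
          (D.run (indepOracle (partitionMatroid (part ∘ σ) fun i => i * g)) : Set (Fin n)) ∧
        m * ((r + 2) * g) <
          (D.run (indepOracle (partitionMatroid (part ∘ σ) fun i => i * g))).card) ⊆
      univ.biUnion B := by
    intro σ hσ
    by_contra hbad
    simp only [mem_biUnion, mem_filter, mem_univ, true_and, B, not_exists, Prod.forall,
      not_and] at hbad hσ
    have hrun := D.run_eq_hybridRun (indepOracle (partitionMatroid (part ∘ σ) fun i => i * g))
      (O σ) fun t k => indepOracle_eq_prefixOracle (hbad (some (t, k)))
    rw [hrun] at hσ
    exact absurd hσ.2 (not_lt.2 (card_le_of_not_unbalanced (hbad none) hσ.1))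
  calc _ ≤ (∑ z, ((B z).card : ℝ)) * Real.exp ((g : ℝ) / (16 * m)) := by
        refine mul_le_mul_of_nonneg_right ?_ (Real.exp_pos _).le
        exact_mod_cast (card_le_card hcover).trans card_biUnion_le
    _ ≤ ∑ z : Option (Fin r × Fin q) × Fin m, (n.factorial : ℝ) := by
        rw [sum_mul]; exact sum_le_sum fun z _ => hB z
    _ = _ := by simp

/-! ### The block partition -/

/-- The map to the parts: part `i + 1` consists of the `i`-th of `m` consecutive blocks of length
`s`, and part `0` of the remaining elements. -/
def blockPart (n m s : ℕ) (a : Fin n) : Fin (m + 1) :=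
  if h : (a : ℕ) < m * s then (finProdFinEquiv.symm ⟨a, h⟩).1.succ else 0

/-- The `k`-th element of the `i`-th block. -/
def blockElem {n m s : ℕ} (h : m * s ≤ n) (i : Fin m) (k : Fin s) : Fin n :=
  Fin.castLE h (finProdFinEquiv (i, k))

theorem blockElem_injective {n m s : ℕ} (h : m * s ≤ n) (i : Fin m) :
    Function.Injective (blockElem h i) := by
  intro k l hkl
  have := finProdFinEquiv.injective (Fin.castLE_injective h hkl)
  exact (Prod.mk.inj this).2

theorem blockPart_eq_succ_iff {n m s : ℕ} (h : m * s ≤ n) (a : Fin n) (i : Fin m) :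
    blockPart n m s a = i.succ ↔ ∃ k, blockElem h i k = a := by
  constructor
  · intro ha
    unfold blockPart at ha
    split_ifs at ha with hlt
    · refine ⟨(finProdFinEquiv.symm ⟨a, hlt⟩).2, ?_⟩
      rw [blockElem, ← Fin.succ_injective _ ha, Prod.mk.eta, Equiv.apply_symm_apply]
      rfl
    · exact absurd ha.symm (Fin.succ_ne_zero i)
  · rintro ⟨k, rfl⟩
    have hlt : ((blockElem h i k : Fin n) : ℕ) < m * s := (finProdFinEquiv (i, k)).2
    have heq : (⟨(blockElem h i k : Fin n), hlt⟩ : Fin (m * s)) = finProdFinEquiv (i, k) := rfl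
    rw [blockPart, dif_pos hlt, heq, Equiv.symm_apply_apply]

/-- Comparing `S` with itself forces `S` to be empty, and then `T` beats it. -/
theorem not_isApproxSolution_of_lt_one {n : ℕ} {M : Matroid (Fin n)} {α : ℝ} (hα : α < 1)
    {T : Finset (Fin n)} (hT : M.Indep (T : Set (Fin n))) (hpos : 0 < T.card)
    (S : Finset (Fin n)) : ¬ IsApproxSolution M (fun S => (S.card : ℝ)) α S := by
  rintro ⟨hS, h⟩
  have h1 := h T hT
  have h2 := h S hS
  have h3 : (0 : ℝ) < T.card := by exact_mod_cast hpos
  have h4 : (0 : ℝ) ≤ S.card := Nat.cast_nonneg _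
  simp only at h1 h2
  have h5 : (S.card : ℝ) = 0 := by nlinarith
  rw [h5, mul_zero] at h1
  linarith

/-! ### Averaging over random bits and relabellings -/

namespace RandomizedAlgorithm

variable {n r q m : ℕ}

open Classical in
theorem hiddenSuccessProb_le (A : RandomizedAlgorithm n r q) (part : Fin n → Fin m)
    (cap : Fin m → ℕ) (α : ℝ) {B : ℝ} (hB : 0 ≤ B)
    (h : ∀ D : QueryAlgorithm n r q,
      ((Finset.univ.filter fun σ : Equiv.Perm (Fin n) =>
        IsApproxSolution (partitionMatroid (part ∘ σ) cap) (fun S => (S.card : ℝ)) α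
          (D.run (indepOracle (partitionMatroid (part ∘ σ) cap)))).card : ℝ) ≤
        B * (n.factorial : ℝ)) :
    A.hiddenSuccessProb part cap α ≤ B := by
  have hfac : (0 : ℝ) < n.factorial := by exact_mod_cast n.factorial_pos
  rw [hiddenSuccessProb, div_le_iff₀ hfac]
  simp only [successProb]
  rw [← ENNReal.toReal_sum]
  swap
  · intro σ _
    refine ne_top_of_le_ne_top ENNReal.one_ne_top ?_
    rw [← A.tsum_coe, PMF.toOuterMeasure_apply]
    exact ENNReal.tsum_le_tsum fun D => Set.indicator_le_self _ _ D
  refine ENNReal.toReal_le_of_le_ofReal (by positivity) ?_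
  simp only [PMF.toOuterMeasure_apply]
  rw [← Summable.tsum_finsetSum fun _ _ => ENNReal.summable]
  calc _ ≤ ∑' D, A D * ENNReal.ofReal (B * n.factorial) := by
        refine ENNReal.tsum_le_tsum fun D => ?_
        simp only [Set.indicator_apply, Set.mem_ofPred_eq]
        rw [← Finset.sum_filter, Finset.sum_const, nsmul_eq_mul, mul_comm]
        gcongr
        rw [← ENNReal.ofReal_natCast]
        exact ENNReal.ofReal_le_ofReal (h D)
    _ = _ := by rw [ENNReal.tsum_mul_right, A.tsum_coe, one_mul]

theorem exists_successProb_le (A : RandomizedAlgorithm n r q) (part : Fin n → Fin m)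
    (cap : Fin m → ℕ) (α : ℝ) :
    ∃ σ : Equiv.Perm (Fin n),
      A.successProb (partitionMatroid (part ∘ σ) cap) α ≤ A.hiddenSuccessProb part cap α := by
  have hfac : (0 : ℝ) < n.factorial := by exact_mod_cast n.factorial_pos
  obtain ⟨σ, _, hσ⟩ := Finset.exists_le_of_sum_le (s := Finset.univ)
    (f := fun σ : Equiv.Perm (Fin n) => A.successProb (partitionMatroid (part ∘ σ) cap) α)
    (g := fun _ => A.hiddenSuccessProb part cap α) Finset.univ_nonempty (by
      rw [Finset.sum_const, Finset.card_univ, Fintype.card_perm, Fintype.card_fin, nsmul_eq_mul,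
        hiddenSuccessProb, mul_div_cancel₀ _ hfac.ne'])
  exact ⟨σ, hσ⟩

end RandomizedAlgorithm

/-! ### Choice of parameters and the final estimate -/

/-- The number of parts of positive capacity. -/
noncomputable def numParts (n : ℕ) : ℕ := ⌊(n : ℝ) ^ (1 / 3 : ℝ) / Real.log n ^ 2⌋₊

/-- The difference between the capacities of consecutive parts. -/
noncomputable def capGap (n : ℕ) : ℕ := numParts n * ⌈Real.log n ^ 2⌉₊

theorem eventually_le_rpow_div_log_sq (K : ℝ) :
    ∀ᶠ n : ℕ in Filter.atTop, K ≤ (n : ℝ) ^ (1 / 3 : ℝ) / Real.log n ^ 2 := by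
  have h := (isLittleO_log_rpow_rpow_atTop (2 : ℝ) (show (0 : ℝ) < 1 / 3 by norm_num)).bound
    (show (0 : ℝ) < (|K| + 1)⁻¹ by positivity)
  filter_upwards [tendsto_natCast_atTop_atTop.eventually h, Filter.eventually_ge_atTop 2]
    with n hn hn2
  have hlog : 0 < Real.log n := Real.log_pos (by exact_mod_cast hn2)
  rw [Real.rpow_two, Real.norm_of_nonneg (by positivity), Real.norm_of_nonneg (by positivity),
    le_inv_mul_iff₀ (by positivity)] at hn
  rw [le_div_iff₀ (by positivity)]
  refine le_trans ?_ hn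
  gcongr
  linarith [le_abs_self K]

/-- The blocks fit: their total size m³⌈log² n⌉ is at most 2n/log⁴ n. -/
theorem numParts_mul_block_le {n : ℕ} (hlog : 2 ≤ Real.log n) :
    numParts n * (numParts n * capGap n) ≤ n := by
  set y : ℝ := (n : ℝ) ^ (1 / 3 : ℝ) with hy
  have hy3 : y ^ 3 = n := by
    rw [hy, ← Real.rpow_natCast, ← Real.rpow_mul (Nat.cast_nonneg _)]; norm_num
  have hy0 : 0 ≤ y := by positivity
  set l := Real.log n with hl
  have hm : (numParts n : ℝ) ≤ y / l ^ 2 := Nat.floor_le (by positivity)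
  have hL : (⌈l ^ 2⌉₊ : ℝ) ≤ 2 * l ^ 2 := by
    have := Nat.ceil_lt_add_one (show 0 ≤ l ^ 2 by positivity)
    nlinarith
  have h1 : ((numParts n * (numParts n * capGap n) : ℕ) : ℝ) ≤ n := by
    calc ((numParts n * (numParts n * capGap n) : ℕ) : ℝ)
        = (numParts n : ℝ) ^ 3 * ⌈l ^ 2⌉₊ := by rw [capGap]; push_cast; ring
      _ ≤ (y / l ^ 2) ^ 3 * (2 * l ^ 2) := by gcongr
      _ = y ^ 3 * (2 / l ^ 4) := by field_simp
      _ ≤ y ^ 3 * 1 := by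
          gcongr
          rw [div_le_one (by positivity)]
          calc (2 : ℝ) ≤ 2 ^ 4 := by norm_num
            _ ≤ l ^ 4 := by gcongr
      _ = n := by rw [mul_one, hy3]
  exact_mod_cast h1

open Classical in
theorem card_approxSolution_le {n r q C : ℕ} {α : ℝ} (hα : 0 < α)
    (hm : max 1 (4 * α) ≤ (n : ℝ) ^ (1 / 3 : ℝ) / Real.log n ^ 2)
    (hlog : 32 * ((C : ℝ) + 3) ≤ Real.log n)
    (hr : (r : ℝ) ≤ (n : ℝ) ^ (1 / 3 : ℝ) / (4 * α * Real.log n ^ 2) - 1) (hq : q ≤ n ^ C)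
    (D : QueryAlgorithm n r q) :
    ((Finset.univ.filter fun σ : Equiv.Perm (Fin n) =>
        IsApproxSolution (partitionMatroid (blockPart n (numParts n) (numParts n * capGap n) ∘ σ)
            fun i => i * capGap n) (fun S => (S.card : ℝ)) α
          (D.run (indepOracle (partitionMatroid
            (blockPart n (numParts n) (numParts n * capGap n) ∘ σ)
              fun i => i * capGap n)))).card : ℝ) ≤
      (n : ℝ) ^ (-(1 / 32 * Real.log n)) * (n.factorial : ℝ) := by
  have hC : (0 : ℝ) ≤ C := Nat.cast_nonneg _
  have hblock := numParts_mul_block_le (n := n) (by linarith)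
  set m := numParts n with hmdef
  set g := capGap n with hg
  set l := Real.log n with hl
  have hl0 : 0 < l := by linarith
  have hn1 : 1 ≤ n := by
    by_contra h
    have : n = 0 := by omega
    simp [hl, this] at hl0
  have hn0 : (0 : ℝ) < n := by exact_mod_cast hn1
  have hm1 : 1 ≤ m := Nat.le_floor (by simpa using (le_max_left _ _).trans hm)
  have hmlt : (n : ℝ) ^ (1 / 3 : ℝ) / l ^ 2 < m + 1 := Nat.lt_floor_add_one _
  have hL : l ^ 2 ≤ (⌈l ^ 2⌉₊ : ℝ) := Nat.le_ceil _
  have hg1 : 1 ≤ g := Nat.mul_pos hm1 (Nat.ceil_pos.2 (by positivity))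
  have he := blockElem_injective hblock
  have hpart := blockPart_eq_succ_iff hblock
  rcases lt_or_ge α 1 with hα1 | hα1
  · rw [Finset.filter_false_of_mem]
    · simp only [Finset.card_empty, Nat.cast_zero]; positivity
    · intro σ _
      obtain ⟨T, hT, hTc⟩ := exists_indep_card he hpart le_rfl σ
      refine not_isApproxSolution_of_lt_one hα1 hT ?_ _
      have : 0 < m * (m + 1) * g := by positivity
      omega
  have hr' : 4 * α * (r + 1) < (m : ℝ) + 1 := by
    have h1 : (r : ℝ) + 1 ≤ (n : ℝ) ^ (1 / 3 : ℝ) / (4 * α * l ^ 2) := by linarith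
    have h2 : (n : ℝ) ^ (1 / 3 : ℝ) / (4 * α * l ^ 2) =
        ((n : ℝ) ^ (1 / 3 : ℝ) / l ^ 2) / (4 * α) := by field_simp
    rw [h2, le_div_iff₀ (by positivity)] at h1
    linarith
  have hr0 : (0 : ℝ) ≤ r := Nat.cast_nonneg _
  have h4 : 4 * α < m + 1 := ((le_max_right _ _).trans hm).trans_lt hmlt
  have hrm : r < m := by
    have : (r : ℝ) < m := by nlinarith
    exact_mod_cast this
  have hcount := card_large_output_mul_le he hpart (g := g) hrm D
  have hsub : (Finset.univ.filter fun σ : Equiv.Perm (Fin n) =>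
        IsApproxSolution (partitionMatroid (blockPart n m (m * g) ∘ σ)
            fun i => i * g) (fun S => (S.card : ℝ)) α
          (D.run (indepOracle (partitionMatroid
            (blockPart n m (m * g) ∘ σ) fun i => i * g)))) ⊆
      (Finset.univ.filter (fun σ : Equiv.Perm (Fin n) =>
        (partitionMatroid (blockPart n m (m * g) ∘ σ) fun i => i * g).Indep
          (D.run (indepOracle (partitionMatroid (blockPart n m (m * g) ∘ σ)
            fun i => i * g)) : Set (Fin n)) ∧
        m * ((r + 2) * g) <
          (D.run (indepOracle (partitionMatroid (blockPart n m (m * g) ∘ σ)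
            fun i => i * g))).card)) := by
    intro σ hσ
    simp only [Finset.mem_filter, Finset.mem_univ, true_and] at hσ ⊢
    refine ⟨hσ.1, ?_⟩
    obtain ⟨T, hT, hTc⟩ := exists_indep_card he hpart le_rfl σ
    have h1 := hσ.2 T hT
    have h2 : 2 * (T.card : ℝ) = m * (m + 1) * g := by exact_mod_cast hTc
    by_contra! hle
    have h3 : ((D.run (indepOracle (partitionMatroid (blockPart n m (m * g) ∘ σ)
            fun i => i * g))).card : ℝ) ≤ m * ((r + 2) * g) := by exact_mod_cast hle
    have h5 := h1.trans (mul_le_mul_of_nonneg_left h3 hα.le)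
    -- Since r+2 ≤ 2(r+1), this follows from the step bound, with its constants 4 and -1.
    have h6 : 2 * α * (r + 2) < (m : ℝ) + 1 := by nlinarith
    have h7 : (0 : ℝ) < m * g := by
      have : 0 < m * g := Nat.mul_pos hm1 hg1
      exact_mod_cast this
    nlinarith [mul_lt_mul_of_pos_left h6 h7]
  have hexp : Real.exp (l ^ 2 / 16) ≤ Real.exp ((g : ℝ) / (16 * m)) := by
    have hm0 : (0 : ℝ) < m := by exact_mod_cast hm1
    refine Real.exp_le_exp.2 ?_
    rw [hg, capGap, ← hmdef, Nat.cast_mul, mul_comm (16 : ℝ), mul_div_mul_left _ _ hm0.ne']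
    gcongr
  have hmn : m ≤ n := by
    refine le_trans ?_ hblock
    exact Nat.le_mul_of_pos_right _ (Nat.mul_pos hm1 hg1)
  -- The union bound may use up half of the exponent l²/16; the other half yields c = 1/32.
  have hpoly : (((r * q + 1) * m : ℕ) : ℝ) ≤ Real.exp (l ^ 2 / 32) := by
    have h1 : (r * q + 1) * m ≤ n ^ (C + 3) := by
      rcases Nat.lt_or_ge n 2 with h | h
      · have : n = 1 := by omega
        simp [hl, this] at hl0
      calc (r * q + 1) * m ≤ (n * n ^ C + n * n ^ C) * n := by
            gcongr
            · exact (hrm.le.trans hmn)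
            · exact Nat.mul_pos hn1 (pow_pos hn1 _)
        _ = 2 * n ^ (C + 2) := by ring
        _ ≤ n * n ^ (C + 2) := by gcongr
        _ = n ^ (C + 3) := by ring
    calc (((r * q + 1) * m : ℕ) : ℝ) ≤ (n : ℝ) ^ (C + 3) := by exact_mod_cast h1
      _ = Real.exp (((C : ℝ) + 3) * l) := by
          have h2 : (C : ℝ) + 3 = (C + 3 : ℕ) := by push_cast; rfl
          rw [h2, Real.exp_nat_mul, hl, Real.exp_log hn0]
      _ ≤ _ := Real.exp_le_exp.2 (by nlinarith)
  have hn : (n : ℝ) ^ (-(1 / 32 * l)) = Real.exp (l ^ 2 / 32) * Real.exp (-(l ^ 2 / 16)) := by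
    rw [Real.rpow_def_of_pos hn0, ← Real.exp_add]
    congr 1
    ring
  have hfac : (0 : ℝ) ≤ n.factorial := Nat.cast_nonneg _
  set N := (Finset.univ.filter fun σ : Equiv.Perm (Fin n) =>
        IsApproxSolution (partitionMatroid (blockPart n m (m * g) ∘ σ)
            fun i => i * g) (fun S => (S.card : ℝ)) α
          (D.run (indepOracle (partitionMatroid
            (blockPart n m (m * g) ∘ σ) fun i => i * g)))).card
  have hfinal : (N : ℝ) * Real.exp (l ^ 2 / 16) ≤ Real.exp (l ^ 2 / 32) * n.factorial := by
    refine le_trans ?_ (hcount.trans (mul_le_mul_of_nonneg_right hpoly hfac))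
    refine mul_le_mul ?_ hexp (Real.exp_pos _).le (Nat.cast_nonneg _)
    exact_mod_cast Finset.card_le_card hsub
  rw [hn, Real.exp_neg, mul_right_comm, ← div_eq_mul_inv, le_div_iff₀ (Real.exp_pos _)]
  exact hfinal

theorem mainTheorem7 :
    ∃ c : ℝ, 0 < c ∧
      ∃ (m : ℕ → ℕ) (part : (n : ℕ) → Fin n → Fin (m n)) (cap : (n : ℕ) → Fin (m n) → ℕ),
        ∀ α : ℝ, 0 < α → ∀ C : ℕ, ∃ n₀ : ℕ, ∀ n : ℕ, n₀ ≤ n →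
          ∀ r q : ℕ,
            (r : ℝ) ≤ (n : ℝ) ^ (1 / 3 : ℝ) / (4 * α * Real.log (n : ℝ) ^ 2) - 1 →
            q ≤ n ^ C →
            ∀ A : RandomizedAlgorithm n r q,
              A.hiddenSuccessProb (part n) (cap n) α ≤ (n : ℝ) ^ (-(c * Real.log (n : ℝ))) ∧
              ∃ σ : Equiv.Perm (Fin n),
                A.successProb (partitionMatroid (part n ∘ σ) (cap n)) α ≤
                  (n : ℝ) ^ (-(c * Real.log (n : ℝ))) := by

  refine ⟨1 / 32, by norm_num, fun n => numParts n + 1,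
    fun n => blockPart n (numParts n) (numParts n * capGap n), fun n i => i * capGap n, ?_⟩
  intro α hα C
  have hlog := (Real.tendsto_log_atTop.comp tendsto_natCast_atTop_atTop).eventually_ge_atTop
    (32 * ((C : ℝ) + 3))
  obtain ⟨n₀, hn₀⟩ := Filter.eventually_atTop.1
    ((eventually_le_rpow_div_log_sq (max 1 (4 * α))).and hlog)
  refine ⟨n₀, fun n hn r q hr hq A => ?_⟩
  have hA := A.hiddenSuccessProb_le (blockPart n (numParts n) (numParts n * capGap n))
    (fun i => i * capGap n) α (Real.rpow_nonneg (Nat.cast_nonneg n) _)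
    (card_approxSolution_le hα (hn₀ n hn).1 (hn₀ n hn).2 hr hq)
  obtain ⟨σ, hσ⟩ := A.exists_successProb_le (blockPart n (numParts n) (numParts n * capGap n))
    (fun i => i * capGap n) α
  exact ⟨hA, σ, hσ.trans hA⟩
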